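/- Let $S$ be a real or complex pre-Hilbert space (inner product space). For $A\subseteq S$ put $A^{\perp}=\{x\in S:\langle x,a\rangle=0\ \forall a\in A\}$. A \emph{pre-Hilbert space logic} is a pair $(S,\mathcal L)$, where $\mathcal L$ is a family of linear subspaces $M$ of $S$ with $M=M^{\perp\perp}$ such that (1) $\{0\}\in\mathcal L$; (2) $M^{\perp}\in\mathcal L$ for every $M\in\mathcal L$; (3) $M+\operatorname{span}\{u\}\in\mathcal L$ for all $M\in\mathcal L$, $u\in S$. Order $\mathcal L$ by inclusion. In a poset $P$, a net $(x_\gamma)$ \emph{o-converges} to $x$ if there are an increasing net $(a_\gamma)$ with supremum $x$ and a decreasing net $(b_\gamma)$ with infimum $x$, over the same index set, such that $a_\gamma\le x_\gamma\le b_\gamma$ for all $\gamma$. A set $X\subseteq P$ is \emph{o-closed} if no net in $X$ o-converges to a point outside $X$; the o-closed sets are the closed sets of the \emph{order topology} $\tau_o(P)$. A map between posets is \emph{o-continuous} if it preserves o-convergence of nets. A \emph{state} on $(S,\mathcal L)$ is a function $s:\mathcal L\to[0,1]$ with $s(S)=1$ and $s(A\vee B)=s(A)+s(B)$ whenever $A,B\in\mathcal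 L$, $A\perp B$, and the supremum $A\vee B$ exists in $\mathcal L$. The \emph{orthogonal dimension} $\dim S$ is the common cardinality of all maximal orthonormal systems of $S$. \textbf{Theorem.} Let $(S,\mathcal L)$ be a pre-Hilbert space logic with $\dim S=\aleph_0$. The following are equivalent: (i) $\tau_o(\mathcal L)$ is a Hausdorff topology; (ii) $S$ is complete, i.e. a Hilbert space; (iii) there is an o-continuous state on $(S,\mathcal L)$. Moreover, the implications (ii)$\Rightarrow$(iii) and (iii)$\Rightarrow$(i) hold for every pre-Hilbert space logic $(S,\mathcal L)$ with $S\neq\{0\}$, without any assumption on $\dim S$. -/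

import Mathlib

universe u v

/-- A net `x : Γ → P` (with `Γ` a directed set) o-converges to `p` if it is squeezed between an
increasing net with supremum `p` and a decreasing net with infimum `p`. -/
def OConverges {P : Type*} [PartialOrder P] {Γ : Type*} [Preorder Γ] (x : Γ → P) (p : P) : Prop :=
  ∃ a b : Γ → P, Monotone a ∧ Antitone b ∧ (∀ γ, a γ ≤ x γ ∧ x γ ≤ b γ) ∧
    IsLUB (Set.range a) p ∧ IsGLB (Set.range b) p

/-- A set is o-closed if no net in it o-converges to a point outside of it. Index sets in the
universe of `P` suffice: a net together with its squeezing nets can be re-indexed by a set of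
triples of elements of `P`. -/
def OClosed {P : Type u} [PartialOrder P] (X : Set P) : Prop :=
  ∀ (Γ : Type u) [Preorder Γ] [IsDirectedOrder Γ] [Nonempty Γ] (x : Γ → P) (p : P),
    (∀ γ, x γ ∈ X) → OConverges x p → p ∈ X

theorem OClosed.empty {P : Type*} [PartialOrder P] : OClosed (∅ : Set P) := by
  intro Γ _ _ _ x p hx _
  exact (hx (Classical.arbitrary Γ)).elim

theorem OClosed.sInter {P : Type*} [PartialOrder P] {A : Set (Set P)} (hA : ∀ X ∈ A, OClosed X) :
    OClosed (⋂₀ A) := by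
  intro Γ _ _ _ x p hx hp X hX
  exact hA X hX Γ x p (fun γ => hx γ X hX) hp

/-- If a net is cofinally in the o-closed set `X`, then its o-limit is in `X`. -/
theorem OClosed.mem_of_cofinal {P : Type u} [PartialOrder P] {X : Set P} (hX : OClosed X)
    {Γ : Type u} [Preorder Γ] [IsDirectedOrder Γ] [Nonempty Γ] {x : Γ → P} {p : P}
    (hp : OConverges x p) (hc : ∀ γ, ∃ δ, γ ≤ δ ∧ x δ ∈ X) : p ∈ X := by
  obtain ⟨a, b, ha, hb, hab, hla, hgb⟩ := hp
  have : Nonempty {γ : Γ // x γ ∈ X} := by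
    obtain ⟨δ, _, hδ⟩ := hc (Classical.arbitrary Γ)
    exact ⟨⟨δ, hδ⟩⟩
  have : IsDirectedOrder {γ : Γ // x γ ∈ X} := by
    refine ⟨fun s t => ?_⟩
    obtain ⟨u, hsu, htu⟩ := exists_ge_ge s.1 t.1
    obtain ⟨δ, hδ, hδX⟩ := hc u
    exact ⟨⟨δ, hδX⟩, hsu.trans hδ, htu.trans hδ⟩
  refine hX {γ : Γ // x γ ∈ X} (fun γ => x γ.1) p (fun γ => γ.2)
    ⟨fun γ => a γ.1, fun γ => b γ.1, fun _ _ h => ha h, fun _ _ h => hb h, fun γ => hab γ.1,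
      ⟨?_, ?_⟩, ⟨?_, ?_⟩⟩
  · rintro _ ⟨γ, rfl⟩
    exact hla.1 ⟨γ.1, rfl⟩
  · intro q hq
    refine hla.2 ?_
    rintro _ ⟨γ, rfl⟩
    obtain ⟨δ, hδ, hδX⟩ := hc γ
    exact (ha hδ).trans (hq ⟨⟨δ, hδX⟩, rfl⟩)
  · rintro _ ⟨γ, rfl⟩
    exact hgb.1 ⟨γ.1, rfl⟩
  · intro q hq
    refine hgb.2 ?_
    rintro _ ⟨γ, rfl⟩
    obtain ⟨δ, hδ, hδX⟩ := hc γ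
    exact (hq ⟨⟨δ, hδX⟩, rfl⟩ : q ≤ b δ).trans (hb hδ)

theorem OClosed.union {P : Type*} [PartialOrder P] {X Y : Set P} (hX : OClosed X)
    (hY : OClosed Y) : OClosed (X ∪ Y) := by
  intro Γ _ _ _ x p hx hp
  by_cases hc : ∀ γ, ∃ δ, γ ≤ δ ∧ x δ ∈ X
  · exact Or.inl (hX.mem_of_cofinal hp hc)
  · right
    push Not at hc
    obtain ⟨γ₀, h₀⟩ := hc
    refine hY.mem_of_cofinal hp fun γ => ?_
    obtain ⟨δ, h₁, h₂⟩ := exists_ge_ge γ γ₀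
    exact ⟨δ, h₁, (hx δ).resolve_left (h₀ δ h₂)⟩

/-- The order topology `τ_o(P)` of a poset: its closed sets are the o-closed sets. (This is not
the topology of Mathlib's class `OrderTopology`.) -/
@[reducible]
def oTopology (P : Type*) [PartialOrder P] : TopologicalSpace P :=
  TopologicalSpace.ofClosed {X : Set P | OClosed X} OClosed.empty
    (fun _ hA => OClosed.sInter hA) (fun _ hX _ hY => OClosed.union hX hY)

/-- A map between posets is o-continuous if it preserves o-convergence of nets. -/
def OContinuous {P : Type u} {Q : Type v} [PartialOrder P] [PartialOrder Q] (f : P → Q) : Prop :=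
  ∀ (Γ : Type u) [Preorder Γ] [IsDirectedOrder Γ] [Nonempty Γ] (x : Γ → P) (p : P),
    OConverges x p → OConverges (fun γ => f (x γ)) (f p)

/-- A set of orthonormal vectors is a maximal orthonormal system of `S` if only the zero vector
is orthogonal to all of its members. -/
def IsMONS (𝕜 : Type*) {S : Type*} [RCLike 𝕜] [NormedAddCommGroup S] [InnerProductSpace 𝕜 S]
    (A : Set S) : Prop :=
  Orthonormal 𝕜 (fun a : A => (a : S)) ∧ ∀ x : S, (∀ a ∈ A, inner 𝕜 a x = 0) → x = 0

/-- The orthogonal dimension of `S`: the cardinality of the maximal orthonormal systems of `S`.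
Such systems exist and all have the same cardinality (`exists_isMONS`, `IsMONS.mk_eq_orthogonalDim`). -/
noncomputable def orthogonalDim (𝕜 : Type*) (S : Type*) [RCLike 𝕜] [NormedAddCommGroup S]
    [InnerProductSpace 𝕜 S] : Cardinal :=
  sInf {c | ∃ A : Set S, IsMONS 𝕜 A ∧ Cardinal.mk A = c}

theorem exists_isMONS (𝕜 : Type*) (S : Type*) [RCLike 𝕜] [NormedAddCommGroup S]
    [InnerProductSpace 𝕜 S] : ∃ A : Set S, IsMONS 𝕜 A := by
  have h0 : Orthonormal 𝕜 (fun a : (∅ : Set S) => (a : S)) :=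
    ⟨fun a => a.2.elim, fun a => a.2.elim⟩
  obtain ⟨w, -, hw, hmax⟩ := exists_maximal_orthonormal h0
  refine ⟨w, hw, fun x hx => ?_⟩
  have h := (maximal_orthonormal_iff_orthogonalComplement_eq_bot hw).1 hmax
  have hxm : x ∈ (Submodule.span 𝕜 w)ᗮ := by
    rw [Submodule.mem_orthogonal]
    intro y hy
    induction hy using Submodule.span_induction with
    | mem y hy => exact hx y hy
    | zero => simp
    | add y z _ _ hy hz => rw [inner_add_left, hy, hz, add_zero]
    | smul c y _ hy => rw [inner_smul_left, hy, mul_zero]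
  rwa [h, Submodule.mem_bot] at hxm

theorem IsMONS.mk_le {𝕜 : Type*} {S : Type*} [RCLike 𝕜] [NormedAddCommGroup S]
    [InnerProductSpace 𝕜 S] {A B : Set S} (hA : IsMONS 𝕜 A) (hB : IsMONS 𝕜 B) :
    Cardinal.mk A ≤ Cardinal.mk B := by
  rcases B.finite_or_infinite with hf | hi
  · have : Finite B := hf
    have hfd : FiniteDimensional 𝕜 (Submodule.span 𝕜 B) := FiniteDimensional.span_of_finite 𝕜 hf
    have htop : Submodule.span 𝕜 B = ⊤ := by
      rw [← Submodule.orthogonal_eq_bot_iff, eq_bot_iff]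
      intro x hx
      refine hB.2 x fun b hb => ?_
      exact (Submodule.mem_orthogonal _ _).1 hx b (Submodule.subset_span hb)
    calc Cardinal.mk A ≤ Module.rank 𝕜 S := hA.1.linearIndependent.cardinal_le_rank
      _ = Module.rank 𝕜 (Submodule.span 𝕜 B) := by rw [htop, rank_top]
      _ ≤ Cardinal.mk B := rank_span_le B
  · have hcov : A ⊆ ⋃ b : B, {a | a ∈ A ∧ inner 𝕜 (b : S) a ≠ 0} := by
      intro a ha
      by_contra hn
      simp only [Set.mem_iUnion, Set.mem_ofPred_eq, not_exists, not_and, not_not] at hn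
      have : a = 0 := hB.2 a fun b hb => hn ⟨b, hb⟩ ha
      have h1 := hA.1.1 ⟨a, ha⟩
      simp [this] at h1
    have hcount : ∀ b : B, Cardinal.mk {a | a ∈ A ∧ inner 𝕜 (b : S) a ≠ 0} ≤ Cardinal.aleph0 := by
      intro b
      rw [Cardinal.le_aleph0_iff_set_countable]
      have hs := (hA.1.inner_products_summable (x := (b : S))).countable_support
      refine (hs.image (fun a : A => (a : S))).mono ?_
      rintro a ⟨ha, hne⟩
      refine ⟨⟨a, ha⟩, ?_, rfl⟩
      rw [Function.mem_support]
      exact pow_ne_zero 2 (norm_ne_zero_iff.2 fun h => hne (inner_eq_zero_symm.1 h))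
    have hBi : Cardinal.aleph0 ≤ Cardinal.mk B := Cardinal.infinite_iff.1 hi.to_subtype
    calc Cardinal.mk A ≤ Cardinal.mk (⋃ b : B, {a | a ∈ A ∧ inner 𝕜 (b : S) a ≠ 0}) :=
          Cardinal.mk_le_mk_of_subset hcov
      _ ≤ Cardinal.sum fun b : B => Cardinal.mk {a | a ∈ A ∧ inner 𝕜 (b : S) a ≠ 0} :=
          Cardinal.mk_iUnion_le_sum_mk
      _ ≤ Cardinal.sum fun _ : B => Cardinal.aleph0 := Cardinal.sum_le_sum _ _ hcount
      _ = Cardinal.mk B := by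
          rw [Cardinal.sum_const', Cardinal.mul_aleph0_eq hBi]

theorem IsMONS.mk_eq_orthogonalDim {𝕜 : Type*} {S : Type*} [RCLike 𝕜] [NormedAddCommGroup S]
    [InnerProductSpace 𝕜 S] {A : Set S} (hA : IsMONS 𝕜 A) :
    Cardinal.mk A = orthogonalDim 𝕜 S := by
  obtain ⟨B, hB, hc⟩ := csInf_mem (s := {c | ∃ A : Set S, IsMONS 𝕜 A ∧ Cardinal.mk A = c})
    ⟨_, A, hA, rfl⟩
  exact (le_antisymm (hA.mk_le hB) (hB.mk_le hA)).trans hc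

/-- A pre-Hilbert space logic on `S`: a family of orthogonally closed linear subspaces that
contains `{0}` and is closed under orthocomplements and one-dimensional perturbations. -/
structure PreHilbertSpaceLogic (𝕜 : Type*) (S : Type*) [RCLike 𝕜] [NormedAddCommGroup S]
    [InnerProductSpace 𝕜 S] where
  carrier : Set (Submodule 𝕜 S)
  orthogonally_closed : ∀ M ∈ carrier, Mᗮᗮ = M
  bot_mem : ⊥ ∈ carrier
  orthogonal_mem : ∀ M ∈ carrier, Mᗮ ∈ carrier
  sup_span_mem : ∀ M ∈ carrier, ∀ u : S, M ⊔ Submodule.span 𝕜 {u} ∈ carrier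

namespace PreHilbertSpaceLogic

/-- The members of the logic, as a poset under inclusion. -/
abbrev Elem {𝕜 : Type*} {S : Type*} [RCLike 𝕜] [NormedAddCommGroup S] [InnerProductSpace 𝕜 S]
    (L : PreHilbertSpaceLogic 𝕜 S) : Type _ :=
  {M : Submodule 𝕜 S // M ∈ L.carrier}

theorem top_mem {𝕜 : Type*} {S : Type*} [RCLike 𝕜] [NormedAddCommGroup S]
    [InnerProductSpace 𝕜 S] (L : PreHilbertSpaceLogic 𝕜 S) : ⊤ ∈ L.carrier := by
  have h := L.orthogonal_mem ⊥ L.bot_mem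
  rwa [Submodule.bot_orthogonal_eq_top] at h

/-- A state: a normalized function into `[0,1]` that is additive on those pairs of orthogonal
members whose join exists in the logic. -/
structure IsState {𝕜 : Type*} {S : Type*} [RCLike 𝕜] [NormedAddCommGroup S]
    [InnerProductSpace 𝕜 S] (L : PreHilbertSpaceLogic 𝕜 S)
    (s : L.Elem → Set.Icc (0 : ℝ) 1) : Prop where
  top_eq_one : (s ⟨⊤, L.top_mem⟩ : ℝ) = 1
  additive : ∀ A B C : L.Elem, A.1 ⟂ B.1 → IsLUB {A, B} C → (s C : ℝ) = (s A : ℝ) + (s B : ℝ)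

end PreHilbertSpaceLogic

/-! ### O-convergence and separation by o-continuous maps -/

open Filter Topology

/-! If `S` is complete, a unit vector `u` gives the state `M ↦ ‖P_M u‖²`. A supremum in the logic
contains no nonzero vector orthogonal to the family (`eq_zero_of_isLUB`), so projections converge
strongly along increasing nets and, through orthocomplements, along decreasing ones. These states
are therefore o-continuous. They also separate the members of the logic, whence the Hausdorff
property.

If `S` is incomplete, let `v` be a vector of the completion outside `S`. A vector of `S` orthogonal
to `S ∩ v^⊥` would be a multiple of `v`, hence is zero. So the orthocomplements of the
finite-dimensional subspaces orthogonal to `v` decrease to `{0}`, although each contains vectors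
arbitrarily near `v`. The version relative to a finite-dimensional `G` is `isGLB_range_finOrtho`; it
drives both remaining implications.

For (i) ⇒ (ii), every o-open set containing `G` contains some `G + span {x}` with `x` as near to `v`
as desired. Iterating from `{0}`, with `x` approximating the vectors `v + e j` for a countable
maximal orthonormal system, gives an increasing sequence in a given o-open neighbourhood of `{0}`
with supremum `S`. Hence `{0}` and `S` cannot be separated.

For (iii) ⇒ (ii), an o-continuous state is small on `Fᗮ` for some such `F`. Taking `v` near a unit
vector `e` of positive value makes `e` nearly orthogonal to `F`, and a three-dimensional estimate
(`IsState.two_mul_lineVal_add_le`) then bounds the value at `e` by less than itself. Thus (iii) ⇒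
(i) passes through completeness. -/

theorem isClosed_oTopology_iff {P : Type*} [PartialOrder P] {X : Set P} :
    IsClosed[oTopology P] X ↔ OClosed X := by
  rw [← @isOpen_compl_iff _ _ (oTopology P)]
  change Xᶜᶜ ∈ {X : Set P | OClosed X} ↔ _
  rw [compl_compl]
  rfl

/-- In the unit interval, o-convergent nets converge in the usual topology. -/
theorem OConverges.tendsto {Γ : Type*} [Preorder Γ] {x : Γ → Set.Icc (0 : ℝ) 1}
    {p : Set.Icc (0 : ℝ) 1} (h : OConverges x p) : Tendsto x atTop (𝓝 p) := by
  obtain ⟨a, b, ha, hb, hab, hla, hgb⟩ := h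
  exact tendsto_of_tendsto_of_tendsto_of_le_of_le (tendsto_atTop_isLUB ha hla)
    (tendsto_atTop_isGLB hb hgb) (fun γ => (hab γ).1) (fun γ => (hab γ).2)

theorem OContinuous.continuous {P : Type u} [PartialOrder P] {f : P → Set.Icc (0 : ℝ) 1}
    (hf : OContinuous f) : @Continuous _ _ (oTopology P) _ f := by
  let := oTopology P
  refine continuous_iff_isClosed.2 fun C hC => isClosed_oTopology_iff.2 ?_
  intro Γ _ _ _ x p hx hp
  exact hC.mem_of_tendsto (hf Γ x p hp).tendsto (Eventually.of_forall hx)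

/-- If the o-continuous maps into the unit interval separate the points of a poset, then its
order topology is Hausdorff. -/
theorem t2Space_oTopology_of_separating {P : Type u} [PartialOrder P]
    (h : ∀ p q : P, p ≠ q → ∃ f : P → Set.Icc (0 : ℝ) 1, OContinuous f ∧ f p ≠ f q) :
    @T2Space P (oTopology P) := by
  let := oTopology P
  refine ⟨fun p q hpq => ?_⟩
  obtain ⟨f, hf, hne⟩ := h p q hpq
  exact separated_by_continuous hf.continuous hne

/-! ### Finite-dimensional perturbations, suprema and orthocomplements in a logic -/

namespace PreHilbertSpaceLogic

variable {𝕜 : Type*} [RCLike 𝕜] {S : Type*} [NormedAddCommGroup S] [InnerProductSpace 𝕜 S]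
  (L : PreHilbertSpaceLogic 𝕜 S)

theorem sup_fg_mem {M F : Submodule 𝕜 S} (hM : M ∈ L.carrier) (hF : F.FG) :
    M ⊔ F ∈ L.carrier := by
  induction F, hF using Submodule.fg_induction generalizing M with
  | singleton u => exact L.sup_span_mem M hM u
  | sup F G _ _ hF hG =>
    rw [← sup_assoc]
    exact hG (hF hM)

theorem fg_mem {F : Submodule 𝕜 S} (hF : F.FG) : F ∈ L.carrier := by
  simpa using L.sup_fg_mem L.bot_mem hF

theorem inf_orthogonal_mem {M F : Submodule 𝕜 S} (hM : M ∈ L.carrier) (hF : F.FG) :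
    M ⊓ Fᗮ ∈ L.carrier := by
  have h := L.orthogonal_mem _ (L.sup_fg_mem (L.orthogonal_mem _ hM) hF)
  rwa [← Submodule.inf_orthogonal, L.orthogonally_closed M hM] at h

variable {L}

/-- The supremum of a family in a logic contains no nonzero vector orthogonal to the family. -/
theorem eq_zero_of_isLUB {T : Set L.Elem} {C : L.Elem} (hC : IsLUB T C) {x : S} (hx : x ∈ C.1)
    (hT : ∀ M ∈ T, x ∈ M.1ᗮ) : x = 0 := by
  have hN := L.inf_orthogonal_mem C.2 (Submodule.fg_span_singleton (R := 𝕜) x)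
  -- Cutting `C` by the hyperplane orthogonal to `x` leaves an upper bound in the logic, so `x` is
  -- orthogonal to itself.
  have hle : C ≤ ⟨_, hN⟩ := hC.2 fun M hM => by
    refine Subtype.coe_le_coe.1 (le_inf (Subtype.coe_le_coe.2 (hC.1 hM)) fun m hm => ?_)
    rw [Submodule.mem_orthogonal_singleton_iff_inner_left]
    exact (Submodule.mem_orthogonal _ _).1 (hT M hM) m hm
  have : x ∈ (Submodule.span 𝕜 {x})ᗮ := (hle hx).2
  rwa [Submodule.mem_orthogonal_singleton_iff_inner_left, inner_self_eq_zero] at this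

theorem orthogonal_le_orthogonal_iff {A B : L.Elem} : A.1ᗮ ≤ B.1ᗮ ↔ B ≤ A := by
  refine ⟨fun h => ?_, fun h => Submodule.orthogonal_le h⟩
  have := Submodule.orthogonal_le h
  rwa [L.orthogonally_closed _ A.2, L.orthogonally_closed _ B.2] at this

/-- The orthocomplementation of the logic. -/
def Elem.compl (M : L.Elem) : L.Elem := ⟨M.1ᗮ, L.orthogonal_mem _ M.2⟩

theorem Elem.compl_le_iff {A B : L.Elem} : A.compl ≤ B ↔ B.compl ≤ A := by
  have hB : B.1 = B.compl.1ᗮ := (L.orthogonally_closed _ B.2).symm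
  rw [← orthogonal_le_orthogonal_iff (A := A), ← Subtype.coe_le_coe, hB]
  rfl

theorem Elem.isLUB_compl {Γ : Type*} {b : Γ → L.Elem} {p : L.Elem}
    (h : IsGLB (Set.range b) p) : IsLUB (Set.range fun γ => (b γ).compl) p.compl := by
  constructor
  · rintro _ ⟨γ, rfl⟩
    exact Submodule.orthogonal_le (h.1 ⟨γ, rfl⟩)
  · intro q hq
    refine Elem.compl_le_iff.2 (h.2 ?_)
    rintro _ ⟨γ, rfl⟩
    exact Elem.compl_le_iff.1 (hq ⟨γ, rfl⟩)

/-! ### Vector states on a Hilbert space -/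

section Complete

variable [CompleteSpace S]

instance (M : L.Elem) : M.1.HasOrthogonalProjection := by
  have hc : IsClosed (M.1 : Set S) := by
    rw [← L.orthogonally_closed _ M.2]
    exact Submodule.isClosed_orthogonal _
  have : CompleteSpace M.1 := hc.completeSpace_coe
  exact Submodule.HasOrthogonalProjection.ofCompleteSpace _

theorem norm_starProjection_mono (u : S) {A B : L.Elem} (h : A ≤ B) :
    ‖A.1.starProjection u‖ ≤ ‖B.1.starProjection u‖ := by
  have h1 := DFunLike.congr_fun (Submodule.starProjection_comp_starProjection_of_le
    (U := A.1) (V := B.1) h) u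
  rw [← h1]
  exact Submodule.norm_starProjection_apply_le _ _

/-- The difference of the two sides lies in `C` and is orthogonal to both `A` and `B`, so
`eq_zero_of_isLUB` applies. -/
theorem starProjection_add_of_isLUB (u : S) {A B C : L.Elem} (hAB : A.1 ⟂ B.1)
    (hC : IsLUB {A, B} C) :
    C.1.starProjection u = A.1.starProjection u + B.1.starProjection u := by
  have hA : A.1 ≤ C.1 := hC.1 (by simp)
  have hB : B.1 ≤ C.1 := hC.1 (by simp)
  have hPA := A.1.starProjection_apply_mem u
  have hPB := B.1.starProjection_apply_mem u
  have hCu := C.1.sub_starProjection_mem_orthogonal u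
  rw [← sub_eq_zero]
  refine eq_zero_of_isLUB hC
    (sub_mem (Submodule.starProjection_apply_mem _ _) (add_mem (hA hPA) (hB hPB))) ?_
  rintro M (rfl | rfl)
  · have h := sub_mem (sub_mem (M.1.sub_starProjection_mem_orthogonal u)
      (Submodule.orthogonal_le hA hCu)) (hAB.symm hPB)
    convert h using 1
    abel
  · have h := sub_mem (sub_mem (M.1.sub_starProjection_mem_orthogonal u)
      (Submodule.orthogonal_le hB hCu)) (hAB hPA)
    convert h using 1
    abel

/-- The limit is the projection onto the closed union `W`, which need not be known to belong to the
logic. Still, `P_p u - P_W u` lies in `p` and is orthogonal to every `a γ`, hence vanishes. -/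
theorem tendsto_starProjection_of_isLUB (u : S) {Γ : Type*} [Preorder Γ] {a : Γ → L.Elem}
    (ha : Monotone a) {p : L.Elem} (hp : IsLUB (Set.range a) p) :
    Tendsto (fun γ => (a γ).1.starProjection u) atTop (𝓝 (p.1.starProjection u)) := by
  have h := Submodule.starProjection_tendsto_closure_iSup (fun γ => (a γ).1) ha u
  set W := (⨆ γ, (a γ).1).topologicalClosure with hW
  have haW : ∀ γ, (a γ).1 ≤ W := fun γ =>
    (le_iSup (fun γ => (a γ).1) γ).trans (Submodule.le_topologicalClosure _)
  have hWp : W ≤ p.1 := by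
    refine Submodule.topologicalClosure_minimal _ (iSup_le fun γ => hp.1 ⟨γ, rfl⟩) ?_
    rw [← L.orthogonally_closed _ p.2]
    exact Submodule.isClosed_orthogonal _
  have heq : p.1.starProjection u = W.starProjection u := by
    rw [← sub_eq_zero]
    refine eq_zero_of_isLUB hp (sub_mem (Submodule.starProjection_apply_mem _ _)
      (hWp (Submodule.starProjection_apply_mem _ _))) ?_
    rintro _ ⟨γ, rfl⟩
    have h1 := sub_mem (Submodule.orthogonal_le (haW γ) (W.sub_starProjection_mem_orthogonal u))
      (Submodule.orthogonal_le (hp.1 ⟨γ, rfl⟩) (p.1.sub_starProjection_mem_orthogonal u))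
    convert h1 using 1
    abel
  rwa [heq]

theorem norm_sq_starProjection_compl (u : S) (M : L.Elem) :
    ‖M.1.starProjection u‖ ^ 2 = ‖u‖ ^ 2 - ‖M.compl.1.starProjection u‖ ^ 2 := by
  rw [M.1.norm_sq_eq_add_norm_sq_starProjection u]
  simp only [Elem.compl]
  ring

/-- The state `M ↦ ‖P_M u‖²` given by a unit vector `u` of a Hilbert space. -/
noncomputable def vectorState (L : PreHilbertSpaceLogic 𝕜 S) (u : S) (hu : ‖u‖ = 1)
    (M : L.Elem) : Set.Icc (0 : ℝ) 1 :=
  ⟨‖M.1.starProjection u‖ ^ 2, sq_nonneg _, by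
    have := M.1.norm_starProjection_apply_le u
    rw [hu] at this
    exact pow_le_one₀ (norm_nonneg _) this⟩

theorem isState_vectorState (u : S) (hu : ‖u‖ = 1) : L.IsState (vectorState L u hu) where
  top_eq_one := by
    simp only [vectorState]
    rw [Submodule.starProjection_eq_self_iff.2 Submodule.mem_top, hu, one_pow]
  additive A B C hAB hC := by
    simp only [vectorState]
    rw [starProjection_add_of_isLUB u hAB hC, sq, sq, sq]
    refine norm_add_sq_eq_norm_sq_add_norm_sq_of_inner_eq_zero (𝕜 := 𝕜) _ _ ?_
    exact Submodule.isOrtho_iff_inner_eq.1 hAB _ (A.1.starProjection_apply_mem u) _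
      (B.1.starProjection_apply_mem u)

theorem vectorState_mono (u : S) (hu : ‖u‖ = 1) : Monotone (vectorState L u hu) :=
  fun _ _ h => pow_le_pow_left₀ (norm_nonneg _) (norm_starProjection_mono u h) 2

theorem oContinuous_vectorState (u : S) (hu : ‖u‖ = 1) : OContinuous (vectorState L u hu) := by
  rintro Γ _ _ _ x p ⟨a, b, ha, hb, hab, hla, hgb⟩
  refine ⟨fun γ => vectorState L u hu (a γ), fun γ => vectorState L u hu (b γ),
    (vectorState_mono u hu).comp ha, (vectorState_mono u hu).comp_antitone hb,
    fun γ => ⟨vectorState_mono u hu (hab γ).1, vectorState_mono u hu (hab γ).2⟩, ?_, ?_⟩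
  · refine isLUB_of_tendsto_atTop ((vectorState_mono u hu).comp ha) ?_
    rw [tendsto_subtype_rng]
    exact (tendsto_starProjection_of_isLUB u ha hla).norm.pow 2
  · refine isGLB_of_tendsto_atTop ((vectorState_mono u hu).comp_antitone hb) ?_
    rw [tendsto_subtype_rng]
    simp only [vectorState]
    rw [norm_sq_starProjection_compl u p]
    simp_rw [fun γ => norm_sq_starProjection_compl u (b γ)]
    refine Tendsto.const_sub _ ?_
    exact (tendsto_starProjection_of_isLUB u (a := fun γ => (b γ).compl)
      (fun _ _ h => Submodule.orthogonal_le (hb h)) (Elem.isLUB_compl hgb)).norm.pow 2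

theorem exists_oContinuous_state [Nontrivial S] (L : PreHilbertSpaceLogic 𝕜 S) :
    ∃ s : L.Elem → Set.Icc (0 : ℝ) 1, L.IsState s ∧ OContinuous s := by
  obtain ⟨x, hx⟩ := exists_ne (0 : S)
  have hu := norm_smul_inv_norm (𝕜 := 𝕜) hx
  exact ⟨vectorState L _ hu, isState_vectorState _ hu, oContinuous_vectorState _ hu⟩

theorem t2Space_of_completeSpace (L : PreHilbertSpaceLogic 𝕜 S) :
    @T2Space L.Elem (oTopology L.Elem) := by
  have key : ∀ A B : L.Elem, ¬ A ≤ B →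
      ∃ f : L.Elem → Set.Icc (0 : ℝ) 1, OContinuous f ∧ f A ≠ f B := by
    intro A B hAB
    obtain ⟨x, hxA, hxB⟩ := SetLike.not_le_iff_exists.1 (show ¬ A.1 ≤ B.1 from hAB)
    have hx : x ≠ 0 := fun h => hxB (h ▸ B.1.zero_mem)
    have hc : (‖x‖ : 𝕜)⁻¹ ≠ 0 := by
      simpa using hx
    have hu := norm_smul_inv_norm (𝕜 := 𝕜) hx
    refine ⟨vectorState L _ hu, oContinuous_vectorState _ hu, fun heq => hxB ?_⟩
    set w := (‖x‖ : 𝕜)⁻¹ • x with hw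
    have hwA : w ∈ A.1 := A.1.smul_mem _ hxA
    have h1 : ‖A.1.starProjection w‖ ^ 2 = ‖B.1.starProjection w‖ ^ 2 := congrArg Subtype.val heq
    rw [Submodule.starProjection_eq_self_iff.2 hwA,
      norm_sq_starProjection_compl w B] at h1
    have h2 : B.1ᗮ.starProjection w = 0 := by
      have h3 : ‖B.compl.1.starProjection w‖ ^ 2 = 0 := by linarith
      exact norm_eq_zero.1 (pow_eq_zero_iff two_ne_zero |>.1 h3)
    rw [Submodule.starProjection_apply_eq_zero_iff, L.orthogonally_closed _ B.2] at h2
    exact (B.1.smul_mem_iff hc).1 h2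
  refine t2Space_oTopology_of_separating fun A B hAB => ?_
  by_cases h : A ≤ B
  · obtain ⟨f, hf, hne⟩ := key B A fun h' => hAB (le_antisymm h h')
    exact ⟨f, hf, hne.symm⟩
  · exact key A B h

end Complete

end PreHilbertSpaceLogic

/-! ### Vectors of the completion outside an incomplete space -/

section Completion

open UniformSpace

variable {𝕜 : Type*} [RCLike 𝕜] {S : Type*} [NormedAddCommGroup S] [InnerProductSpace 𝕜 S]

theorem exists_notMem_range_coe_completion (h : ¬ CompleteSpace S) :
    ∃ v : Completion S, v ∉ Set.range ((↑) : S → Completion S) := by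
  by_contra! hc
  refine h ((Completion.isUniformInducing_coe S).completeSpace_congr (fun v => hc v) |>.2 ?_)
  infer_instance

theorem add_coe_notMem_range_coe_completion {v : Completion S}
    (hv : v ∉ Set.range ((↑) : S → Completion S)) (x : S) :
    v + x ∉ Set.range ((↑) : S → Completion S) := by
  rintro ⟨y, hy⟩
  exact hv ⟨y - x, by rw [Completion.coe_sub, hy, add_sub_cancel_right]⟩

theorem smul_notMem_range_coe_completion {v : Completion S}
    (hv : v ∉ Set.range ((↑) : S → Completion S)) {c : 𝕜} (hc : c ≠ 0) :
    c • v ∉ Set.range ((↑) : S → Completion S) := by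
  rintro ⟨y, hy⟩
  exact hv ⟨c⁻¹ • y, by rw [Completion.coe_smul, hy, inv_smul_smul₀ hc]⟩

/-- Some vector outside of `S` in its completion is as near to a given point as one likes. -/
theorem exists_notMem_range_coe_completion_norm_sub_le (𝕜 : Type*) [RCLike 𝕜]
    [InnerProductSpace 𝕜 S] (h : ¬ CompleteSpace S) (x : S) {ε : ℝ} (hε : 0 < ε) :
    ∃ v : Completion S, v ∉ Set.range ((↑) : S → Completion S) ∧ ‖v - x‖ ≤ ε := by
  obtain ⟨v, hv⟩ := exists_notMem_range_coe_completion h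
  have hv0 : v ≠ 0 := fun h0 => hv ⟨0, by rw [h0, Completion.coe_zero]⟩
  have hn : 0 < ‖v‖ := norm_pos_iff.2 hv0
  have hc : ((ε / ‖v‖ : ℝ) : 𝕜) ≠ 0 := by
    rw [RCLike.ofReal_ne_zero]
    positivity
  refine ⟨((ε / ‖v‖ : ℝ) : 𝕜) • v + x, add_coe_notMem_range_coe_completion
    (smul_notMem_range_coe_completion hv hc) x, ?_⟩
  rw [add_sub_cancel_right, norm_smul, RCLike.norm_ofReal, abs_of_pos (by positivity),
    div_mul_cancel₀ _ hn.ne']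

theorem eq_zero_of_inner_coe_eq_zero {w : Completion S}
    (h : ∀ z : S, inner 𝕜 w (z : Completion S) = 0) : w = 0 := by
  have h2 : ∀ z : Completion S, inner 𝕜 w z = 0 := fun z =>
    Completion.induction_on z
      (isClosed_eq (continuous_const.inner continuous_id) continuous_const) h
  exact inner_self_eq_zero.1 (h2 w)

/-- If `v` is not in `S`, then a vector of `S` orthogonal to all vectors of `S` that are
orthogonal to `v` and to the finite-dimensional subspace `G` belongs to `G`. -/
theorem mem_of_inner_eq_zero_of_notMem_range {G : Submodule 𝕜 S} (hG : G.FG) {v : Completion S}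
    (hv : v ∉ Set.range ((↑) : S → Completion S)) {y : S}
    (hy : ∀ z ∈ Gᗮ, inner 𝕜 v (z : Completion S) = 0 → inner 𝕜 y z = 0) : y ∈ G := by
  have : FiniteDimensional 𝕜 G := Module.Finite.iff_fg.2 hG
  -- Removing the `G`-components of `v` and `y` reduces to the case `G = 0`; `v - g` stays outside
  -- `S` because `g ∈ S`.
  let G' : Submodule 𝕜 (Completion S) := G.map (Completion.toComplₗᵢ (𝕜 := 𝕜) (E := S)).toLinearMap
  obtain ⟨g, hgG, hg⟩ : ∃ g ∈ G, (g : Completion S) = G'.starProjection v :=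
    G'.starProjection_apply_mem v
  have hv' : v - g ∉ Set.range ((↑) : S → Completion S) := by
    have := add_coe_notMem_range_coe_completion hv (-g)
    rwa [Completion.coe_neg, ← sub_eq_add_neg] at this
  have hvG : ∀ z ∈ G, inner 𝕜 (v - g) (z : Completion S) = 0 := by
    intro z hz
    rw [hg]
    exact (Submodule.mem_orthogonal' _ _).1 (G'.sub_starProjection_mem_orthogonal v) _ ⟨z, hz, rfl⟩
  have hg0 : ∀ z ∈ Gᗮ, inner 𝕜 (v - g) (z : Completion S) = inner 𝕜 v (z : Completion S) := by
    intro z hz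
    rw [inner_sub_left, Completion.inner_coe, sub_eq_self]
    exact (Submodule.mem_orthogonal _ _).1 hz g hgG
  have hyG := G.sub_starProjection_mem_orthogonal y
  set y' := y - G.starProjection y with hy'
  have hker : ∀ z : S, inner 𝕜 (v - g) (z : Completion S) = 0 → inner 𝕜 y' z = 0 := by
    intro z hz
    have hzG := G.sub_starProjection_mem_orthogonal z
    have hPz := G.starProjection_apply_mem z
    have h1 : inner 𝕜 y (z - G.starProjection z) = 0 := by
      refine hy _ hzG ?_
      rw [← hg0 _ hzG, Completion.coe_sub, inner_sub_right, hz, hvG _ hPz, sub_zero]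
    have h2 : inner 𝕜 (G.starProjection y) (z - G.starProjection z) = 0 :=
      (Submodule.mem_orthogonal _ _).1 hzG _ (G.starProjection_apply_mem y)
    have h3 : inner 𝕜 y' (G.starProjection z) = 0 := (Submodule.mem_orthogonal' _ _).1 hyG _ hPz
    calc inner 𝕜 y' z = inner 𝕜 y' (z - G.starProjection z) := by
          rw [inner_sub_right, h3, sub_zero]
      _ = 0 := by rw [hy', inner_sub_left, h1, h2, sub_zero]
  have hz0 : ∃ z₀ : S, inner 𝕜 (v - g) (z₀ : Completion S) ≠ 0 := by
    by_contra! hc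
    exact hv' ⟨0, by rw [eq_zero_of_inner_coe_eq_zero hc, Completion.coe_zero]⟩
  obtain ⟨z₀, hz₀⟩ := hz0
  set k : 𝕜 := inner 𝕜 y' z₀ / inner 𝕜 (v - g) (z₀ : Completion S) with hk
  -- The functional of `y'` vanishes on the kernel of that of `v - g`, so it is a multiple of it. A
  -- nonzero multiple would put `v - g` in `S`.
  have hyk : (y' : Completion S) - (starRingEnd 𝕜 k) • (v - g) = 0 := by
    refine eq_zero_of_inner_coe_eq_zero (𝕜 := 𝕜) fun z => ?_
    have h1 := hker (z - (inner 𝕜 (v - g) (z : Completion S) /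
      inner 𝕜 (v - g) (z₀ : Completion S)) • z₀) (by
        rw [Completion.coe_sub, Completion.coe_smul, inner_sub_right, inner_smul_right,
          div_mul_cancel₀ _ hz₀, sub_self])
    rw [inner_sub_right, inner_smul_right] at h1
    rw [inner_sub_left, inner_smul_left, Completion.inner_coe, RCLike.conj_conj, ← h1, hk]
    ring
  by_cases hk0 : k = 0
  · rw [hk0, map_zero, zero_smul, sub_zero, ← Completion.coe_zero, Completion.coe_inj] at hyk
    rw [sub_eq_zero.1 (hy'.symm.trans hyk)]
    exact G.starProjection_apply_mem y
  · have hk1 : starRingEnd 𝕜 k ≠ 0 := (map_ne_zero _).2 hk0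
    exact (smul_notMem_range_coe_completion hv' hk1 ⟨y', sub_eq_zero.1 hyk⟩).elim

/-- A vector of the completion orthogonal to a finite-dimensional subspace of `S` is a limit of
vectors of `S` orthogonal to that subspace. -/
theorem exists_mem_orthogonal_norm_coe_sub_lt {F : Submodule 𝕜 S} (hF : F.FG) {v : Completion S}
    (hv : ∀ z ∈ F, inner 𝕜 v (z : Completion S) = 0) {ε : ℝ} (hε : 0 < ε) :
    ∃ x ∈ Fᗮ, ‖(x : Completion S) - v‖ < ε := by
  have : FiniteDimensional 𝕜 F := Module.Finite.iff_fg.2 hF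
  obtain ⟨_, ⟨y, rfl⟩, hy⟩ := Metric.mem_closure_iff.1 (Completion.denseRange_coe v) ε hε
  refine ⟨y - F.starProjection y, F.sub_starProjection_mem_orthogonal y, ?_⟩
  -- As `v` is orthogonal to `F`, Pythagoras shows that dropping the `F`-component of `y` does not
  -- increase the distance to `v`.
  have hP := F.starProjection_apply_mem y
  set f := F.starProjection y with hf
  have h1 : inner 𝕜 (f : Completion S) (((y - f : S) : Completion S) - v) = 0 := by
    rw [inner_sub_right, Completion.inner_coe, inner_eq_zero_symm.1 (hv f hP), sub_zero]
    exact (Submodule.mem_orthogonal _ _).1 (F.sub_starProjection_mem_orthogonal y) _ hP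
  have h2 := norm_add_sq_eq_norm_sq_add_norm_sq_of_inner_eq_zero _ _ h1
  have h3 : (f : Completion S) + (((y - f : S) : Completion S) - v) = y - v := by
    rw [Completion.coe_sub]
    abel
  rw [h3] at h2
  rw [dist_comm, dist_eq_norm] at hy
  refine lt_of_le_of_lt ?_ hy
  refine le_of_sq_le_sq ?_ (norm_nonneg _)
  nlinarith [mul_self_nonneg ‖(f : Completion S)‖]

end Completion

/-! ### A Hausdorff order topology forces completeness -/

namespace PreHilbertSpaceLogic

open UniformSpace

variable {𝕜 : Type*} [RCLike 𝕜] {S : Type*} [NormedAddCommGroup S] [InnerProductSpace 𝕜 S]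

/-- The finite-dimensional subspaces of `S` that are orthogonal to `G` and to the vector `v` of
the completion. -/
abbrev FinOrtho (G : Submodule 𝕜 S) (v : Completion S) : Type _ :=
  {F : Submodule 𝕜 S // F.FG ∧ F ≤ Gᗮ ∧ ∀ z ∈ F, inner 𝕜 v (z : Completion S) = 0}

instance (G : Submodule 𝕜 S) (v : Completion S) : Nonempty (FinOrtho G v) :=
  ⟨⊥, Submodule.fg_bot, bot_le, by simp [Completion.coe_zero]⟩

instance (G : Submodule 𝕜 S) (v : Completion S) : IsDirectedOrder (FinOrtho G v) := by
  refine ⟨fun A B => ⟨⟨A.1 ⊔ B.1, A.2.1.sup B.2.1, sup_le A.2.2.1 B.2.2.1, ?_⟩, ?_, ?_⟩⟩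
  · intro z hz
    obtain ⟨a, ha, b, hb, rfl⟩ := Submodule.mem_sup.1 hz
    rw [Completion.coe_add, inner_add_right, A.2.2.2 a ha, B.2.2.2 b hb, add_zero]
  · exact Subtype.coe_le_coe.1 le_sup_left
  · exact Subtype.coe_le_coe.1 le_sup_right

variable (L : PreHilbertSpaceLogic 𝕜 S)

/-- The orthocomplements of the finite-dimensional subspaces orthogonal to `G` and `v ∉ S`
decrease to `G`. -/
theorem isGLB_range_finOrtho {G : Submodule 𝕜 S} (hG : G.FG) {v : Completion S}
    (hv : v ∉ Set.range ((↑) : S → Completion S)) :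
    IsGLB (Set.range fun F : FinOrtho G v =>
      (⟨F.1ᗮ, L.orthogonal_mem _ (L.fg_mem F.2.1)⟩ : L.Elem)) ⟨G, L.fg_mem hG⟩ := by
  constructor
  · rintro _ ⟨F, rfl⟩
    exact (Submodule.le_orthogonal_orthogonal G).trans (Submodule.orthogonal_le F.2.2.1)
  · intro N hN y hy
    refine mem_of_inner_eq_zero_of_notMem_range hG hv fun z hz hvz => ?_
    have hF : ∀ w ∈ Submodule.span 𝕜 {z}, inner 𝕜 v (w : Completion S) = 0 := by
      intro w hw
      obtain ⟨c, rfl⟩ := Submodule.mem_span_singleton.1 hw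
      rw [Completion.coe_smul, inner_smul_right, hvz, mul_zero]
    have h := hN ⟨⟨Submodule.span 𝕜 {z}, Submodule.fg_span_singleton z, by simpa using hz, hF⟩,
      rfl⟩
    exact Submodule.mem_orthogonal_singleton_iff_inner_left.1 (h hy)

/-- An o-open set containing the finite-dimensional subspace `G` contains `G + span {x}` for
some `x` arbitrarily near to a given vector of the completion outside of `S`. -/
theorem exists_sup_span_mem {U : Set L.Elem} (hU : OClosed Uᶜ) {G : Submodule 𝕜 S} (hG : G.FG)
    (hGU : ⟨G, L.fg_mem hG⟩ ∈ U) {v : Completion S}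
    (hv : v ∉ Set.range ((↑) : S → Completion S)) {ε : ℝ} (hε : 0 < ε) :
    ∃ x : S, ‖(x : Completion S) - v‖ < ε ∧
      (⟨G ⊔ Submodule.span 𝕜 {x}, L.sup_span_mem _ (L.fg_mem hG) x⟩ : L.Elem) ∈ U := by
  by_contra! hcon
  -- The members `G + span {x F}` lie between `G` and `Fᗮ`, so they o-converge to `G`; they cannot
  -- all avoid `U`.
  choose x hxF hxv using fun F : FinOrtho G v =>
    exists_mem_orthogonal_norm_coe_sub_lt F.2.1 F.2.2.2 hε
  refine hU (FinOrtho G v)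
    (fun F => ⟨G ⊔ Submodule.span 𝕜 {x F}, L.sup_span_mem _ (L.fg_mem hG) (x F)⟩) _
    (fun F => hcon (x F) (hxv F)) ⟨fun _ => ⟨G, L.fg_mem hG⟩,
      fun F => ⟨F.1ᗮ, L.orthogonal_mem _ (L.fg_mem F.2.1)⟩, monotone_const,
      fun _ _ h => Submodule.orthogonal_le h, fun F => ⟨?_, ?_⟩, ?_,
      L.isGLB_range_finOrtho hG hv⟩ hGU
  · exact Subtype.coe_le_coe.1 le_sup_left
  · refine Subtype.coe_le_coe.1 (sup_le ?_ ?_)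
    · exact (Submodule.le_orthogonal_orthogonal G).trans (Submodule.orthogonal_le F.2.2.1)
    · simpa using hxF F
  · rw [Set.range_const]
    exact isLUB_singleton

/-- If `S` has a countable maximal orthonormal system and is not complete, then the top element
is in the closure of every o-open set that contains the bottom element. -/
theorem top_mem_of_oClosed {A : Set S} (hA : IsMONS 𝕜 A) (hAc : A.Countable)
    (hS : ¬ CompleteSpace S) {U C : Set L.Elem} (hU : OClosed Uᶜ) (hC : OClosed C) (hUC : U ⊆ C)
    (hbot : ⟨⊥, L.bot_mem⟩ ∈ U) : ⟨⊤, L.top_mem⟩ ∈ C := by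
  obtain ⟨v, hv⟩ := exists_notMem_range_coe_completion hS
  -- Adjoining `0` makes `v` itself one of the targets `v + e j`, so that `v` can be subtracted at
  -- the end.
  obtain ⟨e, he⟩ := (hAc.insert 0).exists_eq_range (Set.insert_nonempty 0 A)
  -- Unpairing `n` visits every index `j` infinitely often, with errors tending to zero.
  have hstep : ∀ (n : ℕ) (G : {G : Submodule 𝕜 S // ∃ hG : G.FG, ⟨G, L.fg_mem hG⟩ ∈ U}),
      ∃ x : S, ‖(x : Completion S) - (v + e n.unpair.1)‖ < 1 / ((n : ℝ) + 1) ∧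
        (⟨G.1 ⊔ Submodule.span 𝕜 {x}, L.sup_span_mem _ (L.fg_mem G.2.1) x⟩ : L.Elem) ∈ U :=
    fun n G => L.exists_sup_span_mem hU G.2.1 G.2.2
      (add_coe_notMem_range_coe_completion hv _) Nat.one_div_pos_of_nat
  choose x hx hxU using hstep
  let g : ℕ → {G : Submodule 𝕜 S // ∃ hG : G.FG, ⟨G, L.fg_mem hG⟩ ∈ U} :=
    fun n => Nat.rec ⟨⊥, Submodule.fg_bot, hbot⟩
      (fun n G => ⟨G.1 ⊔ Submodule.span 𝕜 {x n G},
        G.2.1.sup (Submodule.fg_span_singleton _), hxU n G⟩) n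
  have hgs : ∀ n, (g (n + 1)).1 = (g n).1 ⊔ Submodule.span 𝕜 {x n (g n)} := fun n => rfl
  have hgm : Monotone fun n => (g n).1 := monotone_nat_of_le_succ fun n => by
    rw [hgs]
    exact le_sup_left
  have hlub : ∀ M : L.Elem, (∀ n, (g n).1 ≤ M.1) → M.1 = ⊤ := by
    intro M hM
    rw [← L.orthogonally_closed _ M.2, Submodule.orthogonal_eq_top_iff, eq_bot_iff]
    intro y hy
    have hxy : ∀ n, inner 𝕜 (x n (g n)) y = 0 := fun n => by
      refine (Submodule.mem_orthogonal _ _).1 hy _ (hM (n + 1) ?_)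
      rw [hgs]
      exact Submodule.mem_sup_right (Submodule.mem_span_singleton_self _)
    have hve : ∀ j, inner 𝕜 (v + e j) (y : Completion S) = 0 := by
      intro j
      have hle : ∀ i : ℕ, ‖inner 𝕜 (v + e j) (y : Completion S)‖ ≤ 1 / ((i : ℝ) + 1) * ‖y‖ := by
        intro i
        have h1 := hx (Nat.pair j i) (g (Nat.pair j i))
        rw [Nat.unpair_pair, norm_sub_rev] at h1
        have h2 : inner 𝕜 (v + e j) (y : Completion S) =
            inner 𝕜 (v + e j - x (Nat.pair j i) (g (Nat.pair j i))) (y : Completion S) := by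
          rw [inner_sub_left, Completion.inner_coe, hxy, sub_zero]
        rw [h2]
        refine (norm_inner_le_norm _ _).trans ?_
        rw [Completion.norm_coe]
        refine mul_le_mul_of_nonneg_right (h1.le.trans ?_) (norm_nonneg _)
        refine one_div_le_one_div_of_le (by positivity) ?_
        exact_mod_cast Nat.succ_le_succ (Nat.right_le_pair j i)
      have hlim := (tendsto_one_div_add_atTop_nhds_zero_nat (𝕜 := ℝ)).mul_const ‖y‖
      rw [zero_mul] at hlim
      exact norm_le_zero_iff.1 (ge_of_tendsto' hlim hle)
    have hvy : inner 𝕜 v (y : Completion S) = 0 := by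
      obtain ⟨j, hj⟩ : (0 : S) ∈ Set.range e := he ▸ Set.mem_insert _ _
      have := hve j
      rwa [hj, Completion.coe_zero, add_zero] at this
    refine hA.2 y fun a ha => ?_
    obtain ⟨j, rfl⟩ : a ∈ Set.range e := he ▸ Set.mem_insert_of_mem _ ha
    have := hve j
    rwa [inner_add_left, hvy, zero_add, Completion.inner_coe] at this
  refine hC (ULift ℕ) (fun n => ⟨(g n.down).1, L.fg_mem (g n.down).2.1⟩) _
    (fun n => hUC (g n.down).2.2)
    ⟨fun n => ⟨(g n.down).1, L.fg_mem (g n.down).2.1⟩, fun _ => ⟨⊤, L.top_mem⟩,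
      fun _ _ h => hgm h, antitone_const, fun n => ⟨le_rfl, Subtype.coe_le_coe.1 le_top⟩,
      ⟨?_, ?_⟩, ?_⟩
  · rintro _ ⟨n, rfl⟩
    exact Subtype.coe_le_coe.1 le_top
  · intro M hM
    exact Subtype.coe_le_coe.1 (hlub M fun n => hM ⟨⟨n⟩, rfl⟩).ge
  · rw [Set.range_const]
    exact isGLB_singleton

theorem completeSpace_of_t2Space (hdim : orthogonalDim 𝕜 S = Cardinal.aleph0)
    (hT : @T2Space L.Elem (oTopology L.Elem)) : CompleteSpace S := by
  by_contra hS
  obtain ⟨A, hA⟩ := exists_isMONS 𝕜 S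
  have hAc : Cardinal.mk A = Cardinal.aleph0 := hA.mk_eq_orthogonalDim.trans hdim
  have hne : (⟨⊥, L.bot_mem⟩ : L.Elem) ≠ ⟨⊤, L.top_mem⟩ := by
    intro h
    have : Subsingleton S := (Submodule.subsingleton_iff 𝕜).1
      (subsingleton_of_bot_eq_top (congrArg Subtype.val h))
    exact hS inferInstance
  let := oTopology L.Elem
  obtain ⟨U, V, hU, hV, hbU, htV, hUV⟩ := hT.t2 hne
  have hUc : OClosed Uᶜ := isClosed_oTopology_iff.1 hU.isClosed_compl
  have hVc : OClosed Vᶜ := isClosed_oTopology_iff.1 hV.isClosed_compl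
  exact L.top_mem_of_oClosed hA (Cardinal.le_aleph0_iff_set_countable.1 hAc.le) hS hUc hVc
    hUV.subset_compl_right hbU htV

end PreHilbertSpaceLogic

/-! ### An o-continuous state forces completeness -/

namespace PreHilbertSpaceLogic

open UniformSpace

variable {𝕜 : Type*} [RCLike 𝕜] {S : Type*} [NormedAddCommGroup S] [InnerProductSpace 𝕜 S]
  {L : PreHilbertSpaceLogic 𝕜 S}

/-- The value of a function on the logic at the line spanned by `x`. -/
noncomputable def lineVal (s : L.Elem → Set.Icc (0 : ℝ) 1) (x : S) : ℝ :=
  s ⟨Submodule.span 𝕜 {x}, L.fg_mem (Submodule.fg_span_singleton x)⟩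

variable {s : L.Elem → Set.Icc (0 : ℝ) 1}

theorem IsState.apply_sup (hs : L.IsState s) {A B : Submodule 𝕜 S} (hA : A ∈ L.carrier)
    (hB : B ∈ L.carrier) (hAB : A ⊔ B ∈ L.carrier) (h : A ⟂ B) :
    (s ⟨A ⊔ B, hAB⟩ : ℝ) = s ⟨A, hA⟩ + s ⟨B, hB⟩ := by
  refine hs.additive ⟨A, hA⟩ ⟨B, hB⟩ ⟨A ⊔ B, hAB⟩ h ⟨?_, ?_⟩
  · rintro M (rfl | rfl)
    · exact Subtype.coe_le_coe.1 le_sup_left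
    · exact Subtype.coe_le_coe.1 le_sup_right
  · intro M hM
    exact Subtype.coe_le_coe.1 (sup_le (hM (by simp) : (⟨A, hA⟩ : L.Elem) ≤ M)
      (hM (by simp) : (⟨B, hB⟩ : L.Elem) ≤ M))

/-- Finite dimension of `A` makes `B` the orthogonal sum of `A` and `Aᗮ ⊓ B`, and puts the latter in
the logic. -/
theorem IsState.apply_le (hs : L.IsState s) {A B : Submodule 𝕜 S} (hA : A ∈ L.carrier)
    (hB : B ∈ L.carrier) (hfg : A.FG) (h : A ≤ B) : s ⟨A, hA⟩ ≤ s ⟨B, hB⟩ := by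
  have : FiniteDimensional 𝕜 A := Module.Finite.iff_fg.2 hfg
  have hB' : A ⊔ Aᗮ ⊓ B = B := Submodule.sup_orthogonal_inf_of_hasOrthogonalProjection h
  have hC : Aᗮ ⊓ B ∈ L.carrier := by
    rw [inf_comm]
    exact L.inf_orthogonal_mem hB hfg
  have h1 := hs.apply_sup hA hC (hB'.symm ▸ hB)
    ((Submodule.isOrtho_orthogonal_right A).mono_right inf_le_left)
  have h2 : (⟨A ⊔ Aᗮ ⊓ B, hB'.symm ▸ hB⟩ : L.Elem) = ⟨B, hB⟩ := Subtype.ext hB'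
  rw [h2] at h1
  rw [← Subtype.coe_le_coe, h1]
  exact le_add_of_nonneg_right (s _).2.1

theorem IsState.apply_bot (hs : L.IsState s) : (s ⟨⊥, L.bot_mem⟩ : ℝ) = 0 := by
  have h := hs.apply_sup L.bot_mem L.bot_mem (by simpa using L.bot_mem)
    (Submodule.isOrtho_bot_left)
  have h2 : (⟨⊥ ⊔ ⊥, by simpa using L.bot_mem⟩ : L.Elem) = ⟨⊥, L.bot_mem⟩ :=
    Subtype.ext (by simp)
  rw [h2] at h
  linarith

theorem IsState.apply_add_apply_orthogonal (hs : L.IsState s) {F : Submodule 𝕜 S} (hF : F.FG) :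
    (s ⟨F, L.fg_mem hF⟩ : ℝ) + s ⟨Fᗮ, L.orthogonal_mem _ (L.fg_mem hF)⟩ = 1 := by
  have : FiniteDimensional 𝕜 F := Module.Finite.iff_fg.2 hF
  have htop : F ⊔ Fᗮ = ⊤ := Submodule.sup_orthogonal_of_hasOrthogonalProjection
  rw [← hs.apply_sup _ _ (htop.symm ▸ L.top_mem) (Submodule.isOrtho_orthogonal_right F)]
  refine Eq.trans ?_ hs.top_eq_one
  congr 3

theorem IsState.lineVal_le (hs : L.IsState s) {B : Submodule 𝕜 S} (hB : B ∈ L.carrier) {x : S}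
    (hx : x ∈ B) : lineVal s x ≤ s ⟨B, hB⟩ :=
  hs.apply_le _ hB (Submodule.fg_span_singleton x) ((Submodule.span_singleton_le_iff_mem _ _).2 hx)

theorem lineVal_smul (s : L.Elem → Set.Icc (0 : ℝ) 1) {c : 𝕜} (hc : c ≠ 0) (x : S) :
    lineVal s (c • x) = lineVal s x := by
  simp only [lineVal, Submodule.span_singleton_smul_eq (IsUnit.mk0 c hc) x]

theorem IsState.lineVal_add_lineVal (hs : L.IsState s) {x y : S} (h : inner 𝕜 x y = 0) :
    lineVal s x + lineVal s y = s ⟨Submodule.span 𝕜 {x} ⊔ Submodule.span 𝕜 {y},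
      L.fg_mem ((Submodule.fg_span_singleton x).sup (Submodule.fg_span_singleton y))⟩ := by
  refine (hs.apply_sup _ _ _ ?_).symm
  rw [Submodule.isOrtho_span]
  rintro _ rfl _ rfl
  exact h

theorem IsState.lineVal_add_le (hs : L.IsState s) {x y : S} (h : inner 𝕜 x y = 0) :
    lineVal s (x + y) ≤ lineVal s x + lineVal s y := by
  rw [hs.lineVal_add_lineVal h]
  exact hs.lineVal_le _ (Submodule.add_mem_sup (Submodule.mem_span_singleton_self x)
    (Submodule.mem_span_singleton_self y))

theorem IsState.lineVal_add_lineVal_le (hs : L.IsState s) {x y x' y' : S}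
    (h : inner 𝕜 x y = 0) (h' : inner 𝕜 x' y' = 0)
    (hx : x ∈ Submodule.span 𝕜 {x'} ⊔ Submodule.span 𝕜 {y'})
    (hy : y ∈ Submodule.span 𝕜 {x'} ⊔ Submodule.span 𝕜 {y'}) :
    lineVal s x + lineVal s y ≤ lineVal s x' + lineVal s y' := by
  rw [hs.lineVal_add_lineVal h, hs.lineVal_add_lineVal h']
  refine hs.apply_le _ _ ((Submodule.fg_span_singleton x).sup (Submodule.fg_span_singleton y)) ?_
  simpa using ⟨hx, hy⟩

/-- If a state is positive at some finite-dimensional subspace, then it is positive at some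
line. -/
theorem IsState.exists_lineVal_pos (hs : L.IsState s) {F : Submodule 𝕜 S} (hF : F.FG)
    (h : 0 < (s ⟨F, L.fg_mem hF⟩ : ℝ)) : ∃ x : S, 0 < lineVal s x := by
  by_contra! hcon
  have key : (s ⟨F, L.fg_mem hF⟩ : ℝ) ≤ 0 := by
    clear h
    induction F, hF using Submodule.fg_sup_span_induction with
    | bot => exact hs.apply_bot.le
    | sup N x hN ih =>
      have : FiniteDimensional 𝕜 N := Module.Finite.iff_fg.2 hN
      -- Gram–Schmidt: the new generator may be taken orthogonal to `N`, where additivity applies.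
      set y := x - N.starProjection x with hy
      have hyN : y ∈ Nᗮ := N.sub_starProjection_mem_orthogonal x
      have hP := N.starProjection_apply_mem x
      have hle : N ⊔ Submodule.span 𝕜 {x} ≤ N ⊔ Submodule.span 𝕜 {y} := by
        refine sup_le le_sup_left ((Submodule.span_singleton_le_iff_mem _ _).2 ?_)
        have : x = N.starProjection x + y := by rw [hy]; abel
        rw [this]
        exact Submodule.add_mem_sup hP (Submodule.mem_span_singleton_self y)
      have hort : N ⟂ Submodule.span 𝕜 {y} := by
        refine Submodule.IsOrtho.symm ?_
        exact (Submodule.span_singleton_le_iff_mem _ _).2 hyN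
      have h1 := hs.apply_sup (L.fg_mem hN) (L.fg_mem (Submodule.fg_span_singleton y))
        (L.sup_span_mem _ (L.fg_mem hN) y) hort
      have h2 : (s _ : ℝ) ≤ s _ := hs.apply_le (L.sup_span_mem _ (L.fg_mem hN) x)
        (L.sup_span_mem _ (L.fg_mem hN) y) (hN.sup (Submodule.fg_span_singleton x)) hle
      have h3 := hcon y
      simp only [lineVal] at h3
      linarith
  linarith

theorem inner_combination {p Q q : S} (hpQ : inner 𝕜 p Q = 0) (hpq : inner 𝕜 p q = 0)
    (hQq : inner 𝕜 Q q = 0) (hp : ‖p‖ = 1) (hq : ‖q‖ = 1) (a b c a' b' c' : ℝ) :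
    inner 𝕜 ((a : 𝕜) • p + (b : 𝕜) • Q + (c : 𝕜) • q)
      ((a' : 𝕜) • p + (b' : 𝕜) • Q + (c' : 𝕜) • q) =
      ((a * a' + b * b' * ‖Q‖ ^ 2 + c * c' : ℝ) : 𝕜) := by
  simp only [inner_add_left, inner_add_right, inner_smul_left, inner_smul_right, hpQ, hpq, hQq,
    inner_eq_zero_symm.1 hpQ, inner_eq_zero_symm.1 hpq, inner_eq_zero_symm.1 hQq,
    inner_self_eq_norm_sq_to_K, hp, hq, RCLike.conj_ofReal]
  push_cast
  ring

/-- If a state is at most `ε` at the lines orthogonal to `F`, then its value at `p + Q` with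
`p ∈ F` and `Q ∈ Fᗮ` long is, up to `ε`, at most half of that at a nearer point `p + c Q`. -/
theorem IsState.two_mul_lineVal_add_le (hs : L.IsState s) {F : Submodule 𝕜 S} {ε : ℝ}
    (hε : ∀ x ∈ Fᗮ, lineVal s x ≤ ε) {p Q q : S} (hp : p ∈ F) (hQ : Q ∈ Fᗮ) (hq : q ∈ Fᗮ)
    (hp1 : ‖p‖ = 1) (hq1 : ‖q‖ = 1) (hQq : inner 𝕜 Q q = 0) (hR : 8 ≤ ‖Q‖ ^ 2) :
    ∃ c : ℝ, 1 / 4 ≤ c ∧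
      2 * lineVal s (p + Q) ≤ lineVal s (p + (c : 𝕜) • Q) + 3 * ε := by
  have hR0 : 0 < ‖Q‖ ^ 2 := by linarith
  have hA : 8 / ‖Q‖ ^ 2 ≤ 1 := (div_le_one hR0).2 hR
  set r := √(1 - 8 / ‖Q‖ ^ 2) with hr
  have hr0 : 0 ≤ r := Real.sqrt_nonneg _
  have hr2 : r ^ 2 = 1 - 8 / ‖Q‖ ^ 2 := Real.sq_sqrt (by linarith)
  have hr3 : r ^ 2 * ‖Q‖ ^ 2 = ‖Q‖ ^ 2 - 8 := by
    rw [hr2, sub_mul, one_mul, div_mul_cancel₀ _ hR0.ne']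
  -- Let `w± = p + c Q ± d q` and `R = ‖Q‖²`. Orthogonality of `w+` and `w-` means `d² = 1 + c² R`;
  -- orthogonality of `w±` to `p + Q - w±` means `d² = c (1 - c) R`. So `c` must solve `2 c² R - c R
  -- + 1 = 0`, which has real roots once `R ≥ 8`; the larger is at least `1/4`.
  set c := (1 + r) / 4 with hc
  have hcc : 1 + c ^ 2 * ‖Q‖ ^ 2 = c * (1 - c) * ‖Q‖ ^ 2 := by
    rw [hc]
    linear_combination hr3 / 8
  set d := √(c * (1 - c) * ‖Q‖ ^ 2) with hd
  have hd2 : d ^ 2 = c * (1 - c) * ‖Q‖ ^ 2 := Real.sq_sqrt (by rw [← hcc]; positivity)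
  have hpQ : inner 𝕜 p Q = 0 := (Submodule.mem_orthogonal _ _).1 hQ p hp
  have hpq : inner 𝕜 p q = 0 := (Submodule.mem_orthogonal _ _).1 hq p hp
  have comb := inner_combination hpQ hpq hQq hp1 hq1
  -- `p + Q` is the orthogonal sum of `w±` and a vector of `Fᗮ`, which contributes at most `ε`.
  have hside : ∀ t : ℝ, t ^ 2 = d ^ 2 →
      lineVal s (p + Q) ≤ lineVal s (((1 : ℝ) : 𝕜) • p + (c : 𝕜) • Q + (t : 𝕜) • q) + ε := by
    intro t ht
    have h1 : p + Q = (((1 : ℝ) : 𝕜) • p + (c : 𝕜) • Q + (t : 𝕜) • q) +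
        (((0 : ℝ) : 𝕜) • p + ((1 - c : ℝ) : 𝕜) • Q + ((-t : ℝ) : 𝕜) • q) := by
      push_cast
      module
    have h2 : ((0 : ℝ) : 𝕜) • p + ((1 - c : ℝ) : 𝕜) • Q + ((-t : ℝ) : 𝕜) • q ∈ Fᗮ := by
      rw [RCLike.ofReal_zero, zero_smul, zero_add]
      exact add_mem (Submodule.smul_mem _ _ hQ) (Submodule.smul_mem _ _ hq)
    rw [h1]
    refine (hs.lineVal_add_le ?_).trans (add_le_add_right (hε _ h2) _)
    rw [comb, RCLike.ofReal_eq_zero]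
    linear_combination -ht - hd2
  -- `w+` and `w-` are orthogonal vectors in the plane of `p + c Q` and `q`.
  have hpair := hs.lineVal_add_lineVal_le
    (x := ((1 : ℝ) : 𝕜) • p + (c : 𝕜) • Q + (d : 𝕜) • q)
    (y := ((1 : ℝ) : 𝕜) • p + (c : 𝕜) • Q + ((-d : ℝ) : 𝕜) • q)
    (x' := p + (c : 𝕜) • Q) (y' := q)
    (by
      rw [comb, RCLike.ofReal_eq_zero]
      linear_combination hcc - hd2)
    (by rw [inner_add_left, inner_smul_left, hpq, hQq, mul_zero, add_zero])
    (by
      rw [RCLike.ofReal_one, one_smul]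
      exact Submodule.add_mem_sup (Submodule.mem_span_singleton_self _)
        (Submodule.smul_mem _ _ (Submodule.mem_span_singleton_self _)))
    (by
      rw [RCLike.ofReal_one, one_smul]
      exact Submodule.add_mem_sup (Submodule.mem_span_singleton_self _)
        (Submodule.smul_mem _ _ (Submodule.mem_span_singleton_self _)))
  refine ⟨c, by rw [hc]; linarith, ?_⟩
  have h1 := hside d rfl
  have h2 := hside (-d) (by ring)
  have h3 := hε q hq
  linarith

theorem IsState.lineVal_add_le_of_le_norm (hs : L.IsState s) {F : Submodule 𝕜 S} {ε : ℝ}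
    (hε0 : 0 ≤ ε) (hε : ∀ x ∈ Fᗮ, lineVal s x ≤ ε) {p q : S} (hp : p ∈ F) (hq : q ∈ Fᗮ)
    (hp1 : ‖p‖ = 1) (hq1 : ‖q‖ = 1) (k : ℕ) {Q : S} (hQ : Q ∈ Fᗮ) (hQq : inner 𝕜 Q q = 0)
    (hR : 3 * 4 ^ k ≤ ‖Q‖) : lineVal s (p + Q) ≤ (1 / 2) ^ k + 3 * ε := by
  -- Passing to `c Q` with `c ≥ 1/4` shortens by a factor of at most `4`, while the bound halves up
  -- to an error; `3 ε` is the fixed point of `t ↦ (t + 3 ε) / 2`.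
  induction k generalizing Q with
  | zero =>
    have : lineVal s (p + Q) ≤ 1 := (s _).2.2
    rw [pow_zero]
    linarith
  | succ k ih =>
    have h4 : (1 : ℝ) ≤ 4 ^ k := one_le_pow₀ (by norm_num)
    rw [pow_succ] at hR
    obtain ⟨c, hc, hle⟩ := hs.two_mul_lineVal_add_le hε hp hQ hq hp1 hq1 hQq (by nlinarith)
    have h1 := ih (Q := (c : 𝕜) • Q) (Submodule.smul_mem _ _ hQ)
      (by rw [inner_smul_left, hQq, mul_zero]) (by
        rw [norm_smul, RCLike.norm_ofReal, abs_of_nonneg (by linarith)]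
        nlinarith)
    rw [pow_succ]
    linarith

/-- An o-continuous state is small at the orthocomplement of some finite-dimensional subspace
orthogonal to a given vector of the completion outside of `S`. -/
theorem IsState.exists_finOrtho_lt (hs : L.IsState s) (hc : OContinuous s) {v : Completion S}
    (hv : v ∉ Set.range ((↑) : S → Completion S)) {ε : ℝ} (hε : 0 < ε) :
    ∃ F : FinOrtho (⊥ : Submodule 𝕜 S) v,
      (s ⟨F.1ᗮ, L.orthogonal_mem _ (L.fg_mem F.2.1)⟩ : ℝ) < ε := by
  have hconv : OConverges (fun F : FinOrtho (⊥ : Submodule 𝕜 S) v =>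
      (⟨F.1ᗮ, L.orthogonal_mem _ (L.fg_mem F.2.1)⟩ : L.Elem)) ⟨⊥, L.bot_mem⟩ := by
    refine ⟨fun _ => ⟨⊥, L.bot_mem⟩, _, monotone_const,
      fun _ _ h => Submodule.orthogonal_le h,
      fun F => ⟨Subtype.coe_le_coe.1 bot_le, le_rfl⟩, ?_,
      L.isGLB_range_finOrtho Submodule.fg_bot hv⟩
    rw [Set.range_const]
    exact isLUB_singleton
  have h := tendsto_subtype_rng.1 (hc _ _ _ hconv).tendsto
  rw [hs.apply_bot] at h
  exact (h.eventually_lt_const hε).exists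

/-- A pre-Hilbert space with an o-continuous state on some logic is complete. -/
theorem completeSpace_of_oContinuous_state (hs : L.IsState s) (hc : OContinuous s) :
    CompleteSpace S := by
  by_contra hS
  obtain ⟨v₀, hv₀⟩ := exists_notMem_range_coe_completion hS
  obtain ⟨F₀, hF₀⟩ := hs.exists_finOrtho_lt hc hv₀ one_pos
  obtain ⟨x, hx⟩ := hs.exists_lineVal_pos F₀.2.1
    (by linarith [hs.apply_add_apply_orthogonal F₀.2.1])
  have hx0 : x ≠ 0 := by
    rintro rfl
    exact hx.not_ge ((hs.lineVal_le L.bot_mem (Submodule.zero_mem _)).trans hs.apply_bot.le)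
  obtain ⟨e, he1, heq⟩ : ∃ e : S, ‖e‖ = 1 ∧ lineVal s e = lineVal s x :=
    ⟨_, norm_smul_inv_norm (𝕜 := 𝕜) hx0, lineVal_smul s (by simpa using hx0) x⟩
  rw [← heq] at hx
  -- With `ε` an eighth of the value at `e`, the bound `(1/2)^k + 3 ε` falls below `7/8` of that
  -- value.
  obtain ⟨k, hk⟩ := exists_pow_lt_of_lt_one (half_pos hx) (by norm_num : (1 / 2 : ℝ) < 1)
  -- Chosen so that `(1 - η) / η = 3 * 4 ^ k`, the length required of `Q` once `p` is normalized.
  set η : ℝ := 1 / (3 * 4 ^ k + 1) with hη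
  have hη0 : 0 < η := by positivity
  obtain ⟨v, hv, hve⟩ := exists_notMem_range_coe_completion_norm_sub_le 𝕜 hS e hη0
  obtain ⟨F, hF⟩ := hs.exists_finOrtho_lt hc hv (ε := lineVal s e / 8) (by linarith)
  have : FiniteDimensional 𝕜 F.1 := Module.Finite.iff_fg.2 F.2.1
  have hε : ∀ y ∈ F.1ᗮ, lineVal s y ≤ lineVal s e / 8 := fun y hy =>
    (hs.lineVal_le (L.orthogonal_mem _ (L.fg_mem F.2.1)) hy).trans hF.le
  have hP := F.1.starProjection_apply_mem e
  have hQ := F.1.sub_starProjection_mem_orthogonal e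
  set p := F.1.starProjection e with hp
  set Q := e - p with hQe
  -- Since `p ∈ F` is orthogonal to `v`, `‖p‖² = ⟨e, p⟩ = ⟨e - v, p⟩ ≤ η ‖p‖`.
  have hpe : ‖p‖ ≤ η := by
    have h1 : ‖p‖ ^ 2 = ‖inner 𝕜 ((e : Completion S) - v) (p : Completion S)‖ := by
      rw [inner_sub_left, F.2.2.2 p hP, sub_zero, Completion.inner_coe]
      have h2 : inner 𝕜 e p = inner 𝕜 p p := by
        have h3 : inner 𝕜 Q p = 0 := (Submodule.mem_orthogonal' _ _).1 hQ p hP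
        rwa [hQe, inner_sub_left, sub_eq_zero] at h3
      rw [h2, inner_self_eq_norm_sq_to_K]
      simp
    have h2 := norm_inner_le_norm (𝕜 := 𝕜) ((e : Completion S) - v) (p : Completion S)
    rw [← h1, Completion.norm_coe, norm_sub_rev] at h2
    rcases (norm_nonneg p).eq_or_lt with h0 | h0
    · rw [← h0]
      exact hη0.le
    · nlinarith
  have hp0 : p ≠ 0 := by
    intro h0
    have := hε e (by rwa [hQe, h0, sub_zero] at hQ)
    linarith
  have hpn : 0 < ‖p‖ := norm_pos_iff.2 hp0
  have hc0 : (‖p‖ : 𝕜)⁻¹ ≠ 0 := by simpa using hp0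
  -- The auxiliary third direction exists because an incomplete space is infinite-dimensional.
  obtain ⟨q, hq1, hqF⟩ : ∃ q : S, ‖q‖ = 1 ∧ q ∈ (F.1 ⊔ Submodule.span 𝕜 {e})ᗮ := by
    have hfin : FiniteDimensional 𝕜 ↥(F.1 ⊔ Submodule.span 𝕜 {e}) := inferInstance
    have hne : (F.1 ⊔ Submodule.span 𝕜 {e})ᗮ ≠ ⊥ := by
      intro hbot
      rw [Submodule.orthogonal_eq_bot_iff] at hbot
      rw [hbot] at hfin
      have : FiniteDimensional 𝕜 S := Module.finite_def.2 (Module.Finite.iff_fg.1 hfin)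
      exact hS (FiniteDimensional.complete 𝕜 S)
    obtain ⟨y, hy, hy0⟩ := Submodule.exists_mem_ne_zero_of_ne_bot hne
    exact ⟨_, norm_smul_inv_norm (𝕜 := 𝕜) hy0, Submodule.smul_mem _ _ hy⟩
  have hqF' : q ∈ F.1ᗮ := Submodule.orthogonal_le le_sup_left hqF
  have hqQ : inner 𝕜 Q q = 0 := by
    rw [hQe, inner_sub_left, (Submodule.mem_orthogonal _ _).1 hqF' p hP, sub_zero]
    exact (Submodule.mem_orthogonal _ _).1 hqF e
      (Submodule.mem_sup_right (Submodule.mem_span_singleton_self e))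
  have hQn : 1 - η ≤ ‖Q‖ := by
    have := norm_sub_norm_le e p
    rw [he1] at this
    linarith
  have hbig : 3 * 4 ^ k ≤ ‖(‖p‖ : 𝕜)⁻¹ • Q‖ := by
    rw [norm_smul, norm_inv, RCLike.norm_ofReal, abs_norm, inv_mul_eq_div, le_div_iff₀ hpn]
    have h1 : η * (3 * 4 ^ k + 1) = 1 := by
      rw [hη]
      field_simp
    have h2 : (0 : ℝ) < 4 ^ k := by positivity
    nlinarith
  have hfinal := hs.lineVal_add_le_of_le_norm (by linarith) hε (Submodule.smul_mem _ _ hP) hqF'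
    (norm_smul_inv_norm (𝕜 := 𝕜) hp0) hq1 k (Submodule.smul_mem _ (‖p‖ : 𝕜)⁻¹ hQ)
    (by rw [inner_smul_left, hqQ, mul_zero]) hbig
  rw [← smul_add, lineVal_smul s hc0, hQe, add_sub_cancel] at hfinal
  linarith

end PreHilbertSpaceLogic

/-! ### The equivalence -/

theorem mainTheorem1 {𝕜 : Type*} [RCLike 𝕜] {S : Type*} [NormedAddCommGroup S]
    [InnerProductSpace 𝕜 S] (L : PreHilbertSpaceLogic 𝕜 S) :
    (orthogonalDim 𝕜 S = Cardinal.aleph0 →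
      [@T2Space L.Elem (oTopology L.Elem),
        CompleteSpace S,
        ∃ s : L.Elem → Set.Icc (0 : ℝ) 1, L.IsState s ∧ OContinuous s].TFAE) ∧
    (Nontrivial S → CompleteSpace S →
      ∃ s : L.Elem → Set.Icc (0 : ℝ) 1, L.IsState s ∧ OContinuous s) ∧
    ((∃ s : L.Elem → Set.Icc (0 : ℝ) 1, L.IsState s ∧ OContinuous s) →
      @T2Space L.Elem (oTopology L.Elem)) := by
  have h31 : (∃ s : L.Elem → Set.Icc (0 : ℝ) 1, L.IsState s ∧ OContinuous s) →
      @T2Space L.Elem (oTopology L.Elem) := by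
    rintro ⟨s, hs, hc⟩
    have := PreHilbertSpaceLogic.completeSpace_of_oContinuous_state hs hc
    exact PreHilbertSpaceLogic.t2Space_of_completeSpace L
  refine ⟨fun hdim => ?_, fun _ _ => L.exists_oContinuous_state, h31⟩
  -- Dimension `ℵ₀` excludes the zero space, whose orthonormal systems are finite.
  have hnt : Nontrivial S := by
    by_contra hS
    rw [not_nontrivial_iff_subsingleton] at hS
    obtain ⟨A, hA⟩ := exists_isMONS 𝕜 S
    have h := hA.mk_eq_orthogonalDim.trans hdim
    exact (Cardinal.mk_lt_aleph0 (α := A)).ne h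
  tfae_have 1 → 2 := L.completeSpace_of_t2Space hdim
  tfae_have 2 → 3 := fun _ => L.exists_oContinuous_state
  tfae_have 3 → 1 := h31
  tfae_finish
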